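/- Let $n\in\mathbb N$, $T>0$; $|\cdot|$ and $\langle\cdot,\cdot\rangle$ are Euclidean, $B_R$ is the closed ball of radius $R$ about $0$ in $\mathbb R^n$, $\mathbb R^{n+1}=\mathbb R^n\times\mathbb R$, and $\mathbb B$ is the closed unit ball of $\mathbb R^{n+1}$. Measurable means Lebesgue measurable. For $H:[0,T]\times\mathbb R^n\times\mathbb R^n\to\mathbb R$ put $$L(t,x,v)=\sup_{p\in\mathbb R^n}\{\langle v,p\rangle-H(t,x,p)\},\quad \mathrm{dom}\,L(t,x,\cdot)=\{v: L(t,x,v)\ne\pm\infty\},\quad E_L(t,x)=\{(v,\eta)\in\mathbb R^{n}\times\mathbb R: L(t,x,v)\le\eta\}.$$ For $c:[0,T]\to[0,\infty)$ and $\lambda:[0,T]\times\mathbb R^n\to\mathbb R$ consider the conditions: - (H1) $H(\cdot,x,p)$ is measurable for all $x,p$; - (H2) $H(t,\cdot,\cdot)$ is continuous for every $t$; - (H3) $H(t,x,\cdot)$ is convex for all $t,x$; - (H4) $c$ is measurable and $|H(t,x,p)-H(t,x,q)|\le c(t)(1+|x|)|p-q|$ for all $t,x,p,q$; - (HLC)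 for every $R>0$ there is a measurable $k_R:[0,T]\to[0,\infty)$ with $|H(t,x,p)-H(t,y,p)|\le k_R(t)(1+|p|)|x-y|$ for all $t$, all $x,y\in B_R$ and all $p$; - (BLC) $\lambda$ is measurable in $t$ for every $x$ and continuous in $x$ for every $t$; $L(t,x,v)\le\lambda(t,x)$ for all $(t,x)$ and all $v\in\mathrm{dom}\,L(t,x,\cdot)$; and for every $R>0$ there is a measurable $k_R:[0,T]\to[0,\infty)$ such that $\lambda(t,\cdot)$ is $k_R(t)$-Lipschitz on $B_R$ for every $t$. If these hold, define the representation $(\mathbb B,f,l)$ of $H$ associated with $(H,\lambda,c)$ as follows. Let $\omega(t,x)=|\lambda(t,x)|+|H(t,x,0)|+c(t)(1+|x|)+1$. For $y\in\mathbb R^{n+1}$ and a nonempty closed convex $K\subset\mathbb R^{n+1}$ let $P(y,K)=K\cap\{z:|z-y|\le 2\,d(y,K)\}$, where $d(y,K)=\inf_{z\in K}|y-z|$. For a nonempty compact convex $K\subset\mathbb R^{n+1}$ let $$s_{n+1}(K)=(n+1)\int_{\{|p|=1\}}p\,\Big(\max_{z\in K}\langle p,z\rangle\Big)\,\mu(dp)$$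 be its Steiner point, $\mu$ being the surface measure of the unit sphere of $\mathbb R^{n+1}$ normalized to total mass $1$. Then, for $(t,x,a)\in[0,T]\times\mathbb R^n\times\mathbb B$, $$\big(f(t,x,a),\,l(t,x,a)\big):=s_{n+1}\big(P(\omega(t,x)\,a,\;E_L(t,x))\big)\in\mathbb R^n\times\mathbb R .$$ **Theorem.** Let $H_i,\lambda_i,c_i$ ($i\in\mathbb N$) and $H,\lambda,c$ satisfy (H1)–(H4), (HLC) and (BLC), and let $H_i,\lambda_i,c_i$ be continuous for every $i\in\mathbb N$. Let $(\mathbb B,f_i,l_i)$ and $(\mathbb B,f,l)$ be the representations associated with $(H_i,\lambda_i,c_i)$ and $(H,\lambda,c)$. If $H_i\to H$, $\lambda_i\to\lambda$ and $c_i\to c$ uniformly on compact subsets of $[0,T]\times\mathbb R^n\times\mathbb R^n$, $[0,T]\times\mathbb R^n$ and $[0,T]$, respectively, then $f_i\to f$ and $l_i\to l$ uniformly on compact subsets of $[0,T]\times\mathbb R^n\times\mathbb B$. -/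

import Mathlib

open MeasureTheory Set Filter Metric
open scoped RealInnerProductSpace

noncomputable section

namespace HJRep

/-- `ℝⁿ` with its Euclidean norm. -/
abbrev Rn (n : ℕ) : Type := EuclideanSpace ℝ (Fin n)

/-- `ℝⁿ⁺¹ = ℝⁿ × ℝ` with the Euclidean norm `|(v, η)|² = |v|² + |η|²`. -/
abbrev Rn1 (n : ℕ) : Type := WithLp 2 (Rn n × ℝ)

/-- The closed unit ball of `ℝⁿ⁺¹`, the control set. -/
abbrev UnitBall (n : ℕ) : Type := closedBall (0 : Rn1 n) 1

/-- The time interval `[0,T]`. -/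
abbrev Time (T : ℝ) : Type := Icc (0 : ℝ) T

/-- Lebesgue measurability of a function on `[0,T]`: preimages of Borel sets are Lebesgue
measurable, that is, null-measurable for the Lebesgue measure of `[0,T]`. -/
def LebesgueMeasurable {T : ℝ} (g : Time T → ℝ) : Prop :=
  NullMeasurable g (Measure.comap Subtype.val (volume : Measure ℝ))

/-- Uniform convergence on every compact subset of `X`. -/
def TendstoUniformlyOnCompacts {X Y : Type*} [TopologicalSpace X] [UniformSpace Y]
    (F : ℕ → X → Y) (G : X → Y) : Prop :=
  ∀ K : Set X, IsCompact K → TendstoUniformlyOn F G atTop K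

section Hamiltonian

variable {n : ℕ} {T : ℝ}

/-- The Lagrangian: the Legendre-Fenchel transform of `H` in its last variable,
with values in `[-∞, +∞]`. -/
def lagrangian (H : Time T → Rn n → Rn n → ℝ) (t : Time T) (x v : Rn n) : EReal :=
  ⨆ p : Rn n, ((⟪v, p⟫ - H t x p : ℝ) : EReal)

/-- The effective domain of an extended-real-valued function. -/
def effDom (φ : Rn n → EReal) : Set (Rn n) := {v | φ v ≠ ⊤ ∧ φ v ≠ ⊥}

/-- `E_L(t,x)`, the epigraph of `L(t,x,·)`, as a subset of `ℝⁿ⁺¹`. -/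
def epiLagrangian (H : Time T → Rn n → Rn n → ℝ) (t : Time T) (x : Rn n) : Set (Rn1 n) :=
  {z | lagrangian H t x z.fst ≤ (z.snd : EReal)}

/-- (H1): `H` is Lebesgue measurable in `t`. -/
def CondH1 (H : Time T → Rn n → Rn n → ℝ) : Prop :=
  ∀ x p : Rn n, LebesgueMeasurable (fun t => H t x p)

/-- (H2): `H` is continuous in `(x,p)`. -/
def CondH2 (H : Time T → Rn n → Rn n → ℝ) : Prop :=
  ∀ t : Time T, Continuous fun z : Rn n × Rn n => H t z.1 z.2

/-- (H3): `H` is convex in `p`. -/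
def CondH3 (H : Time T → Rn n → Rn n → ℝ) : Prop :=
  ∀ (t : Time T) (x : Rn n), ConvexOn ℝ univ (H t x)

/-- (H4), with the map `c`. -/
def CondH4 (H : Time T → Rn n → Rn n → ℝ) (c : Time T → ℝ) : Prop :=
  LebesgueMeasurable c ∧ (∀ t, 0 ≤ c t) ∧
    ∀ (t : Time T) (x p q : Rn n), |H t x p - H t x q| ≤ c t * (1 + ‖x‖) * ‖p - q‖

/-- (HLC): local Lipschitz continuity of `H` in `x`. -/
def CondHLC (H : Time T → Rn n → Rn n → ℝ) : Prop :=
  ∀ R : ℝ, 0 < R → ∃ k : Time T → ℝ, LebesgueMeasurable k ∧ (∀ t, 0 ≤ k t) ∧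
    ∀ t : Time T, ∀ x ∈ closedBall (0 : Rn n) R, ∀ y ∈ closedBall (0 : Rn n) R, ∀ p : Rn n,
      |H t x p - H t y p| ≤ k t * (1 + ‖p‖) * ‖x - y‖

/-- (BLC) for the Lagrangian of `H`, with the map `lam`: `lam` bounds `L` on its effective
domain and is locally Lipschitz continuous in `x`. -/
def CondBLC (H : Time T → Rn n → Rn n → ℝ) (lam : Time T → Rn n → ℝ) : Prop :=
  (∀ x, LebesgueMeasurable (fun t => lam t x)) ∧
  (∀ t, Continuous (lam t)) ∧
  (∀ (t : Time T) (x : Rn n), ∀ v ∈ effDom (lagrangian H t x),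
    lagrangian H t x v ≤ (lam t x : EReal)) ∧
  ∀ R : ℝ, 0 < R → ∃ k : Time T → ℝ, LebesgueMeasurable k ∧ (∀ t, 0 ≤ k t) ∧
    ∀ t : Time T, ∀ x ∈ closedBall (0 : Rn n) R, ∀ y ∈ closedBall (0 : Rn n) R,
      |lam t x - lam t y| ≤ k t * ‖x - y‖

/-- `H` satisfies (H1)-(H4) and (HLC), its Lagrangian satisfies (BLC), where `c` is the map in
(H4) and `lam` the map in (BLC). -/
structure StandingHyp (H : Time T → Rn n → Rn n → ℝ) (lam : Time T → Rn n → ℝ)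
    (c : Time T → ℝ) : Prop where
  h1 : CondH1 H
  h2 : CondH2 H
  h3 : CondH3 H
  h4 : CondH4 H c
  hlc : CondHLC H
  blc : CondBLC H lam

end Hamiltonian

section Steiner

variable {E : Type*} [NormedAddCommGroup E] [InnerProductSpace ℝ E]

/-- The support function `σ(K,p) = max_{x ∈ K} ⟨p,x⟩` (of a nonempty compact set `K`). -/
def supportFun (K : Set E) (p : E) : ℝ := sSup ((fun x => ⟪p, x⟫) '' K)

/-- The Steiner point `s_m(K) = m ∫ p σ(K,p) μ(dp)`, where `m = dim E` and `μ` is the surface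
measure of the unit sphere normalized to total mass one (whence the mean value integral). -/
def steinerPoint [FiniteDimensional ℝ E] [MeasurableSpace E] [BorelSpace E] (K : Set E) : E :=
  (Module.finrank ℝ E : ℝ) •
    ⨍ p : sphere (0 : E) 1, supportFun K (p : E) • (p : E) ∂(volume : Measure E).toSphere

/-- `P(y,K) = K ∩ B(y, 2 d(y,K))`. -/
def nearSet (y : E) (K : Set E) : Set E := K ∩ closedBall y (2 * infDist y K)

end Steiner

section Representation

variable {n : ℕ} {T : ℝ}

/-- `ω(t,x) = |λ(t,x)| + |H(t,x,0)| + c(t)(1+|x|) + 1`. -/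
def omega (H : Time T → Rn n → Rn n → ℝ) (lam : Time T → Rn n → ℝ) (c : Time T → ℝ)
    (t : Time T) (x : Rn n) : ℝ :=
  |lam t x| + |H t x 0| + c t * (1 + ‖x‖) + 1

/-- The parametrization `e(t,x,a) = s_{n+1}(P(ω(t,x) a, E_L(t,x)))` of the epigraph. -/
def epiParam (H : Time T → Rn n → Rn n → ℝ) (lam : Time T → Rn n → ℝ) (c : Time T → ℝ)
    (t : Time T) (x : Rn n) (a : UnitBall n) : Rn1 n :=
  steinerPoint (nearSet (omega H lam c t x • (a : Rn1 n)) (epiLagrangian H t x))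

/-- The function `f` of the representation: the `ℝⁿ`-component of `e`. -/
def reprF (H : Time T → Rn n → Rn n → ℝ) (lam : Time T → Rn n → ℝ) (c : Time T → ℝ)
    (t : Time T) (x : Rn n) (a : UnitBall n) : Rn n :=
  (epiParam H lam c t x a).fst

/-- The function `l` of the representation: the last component of `e`. -/
def reprL (H : Time T → Rn n → Rn n → ℝ) (lam : Time T → Rn n → ℝ) (c : Time T → ℝ)
    (t : Time T) (x : Rn n) (a : UnitBall n) : ℝ :=
  (epiParam H lam c t x a).snd

end Representation

end HJRep

end

open scoped Topology

/-! Convergence uniform on compacts to a continuous limit amounts to convergence along all sequences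
`(t_k, x_k, a_k)` that converge. Along such a sequence the frozen Hamiltonians `H_k(t_k, x_k, ·)`
are convex, share a Lipschitz constant, and converge locally uniformly. It remains to pass this
convergence through each stage of the construction.

The epigraphs of the conjugates converge in Kuratowski's sense (`kuratowskiTendsto_conjEpi`). The
inequalities defining them pass to the limit. Conversely, a limit point is recovered by quadratic
regularization, since its velocity may lie outside the domains of the approximating Lagrangians.

Cutting with the balls of radius `2 d` preserves this convergence (`KuratowskiTendsto.nearSet`)
thanks to convexity and the room left by the factor 2. The cut sets are uniformly bounded, so their
support functions converge pointwise, and dominated convergence gives their Steiner points. -/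

namespace HJRep

/-! ### Sequential and Kuratowski convergence -/

section Convergence

/-- Continuous convergence along sequences implies locally uniform convergence. -/
theorem tendstoLocallyUniformly_of_seq {X Y : Type*} [TopologicalSpace X]
    [FirstCountableTopology X] [UniformSpace Y] {F : ℕ → X → Y} {G : X → Y}
    (hG : Continuous G)
    (h : ∀ (φ : ℕ → ℕ) (u : ℕ → X) (x : X), Tendsto φ atTop atTop → Tendsto u atTop (𝓝 x) →
      Tendsto (fun k => F (φ k) (u k)) atTop (𝓝 (G x))) :
    TendstoLocallyUniformly F G atTop := by
  rw [tendstoLocallyUniformly_iff_filter]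
  intro x
  rw [tendstoUniformlyOnFilter_iff_tendsto]
  -- `atTop ×ˢ 𝓝 x` is countably generated, so sequences of pairs (index, point) suffice.
  refine tendsto_of_seq_tendsto fun u hu => ?_
  have h1 : Tendsto (fun k => (u k).1) atTop atTop := tendsto_fst.comp hu
  have h2 : Tendsto (fun k => (u k).2) atTop (𝓝 x) := tendsto_snd.comp hu
  exact Tendsto.mono_right
    (((hG.tendsto x).comp h2).prodMk_nhds (h _ _ x h1 h2)) (nhds_le_uniformity (G x))

theorem _root_.TendstoLocallyUniformly.comp_index {X Y ι κ : Type*} [TopologicalSpace X]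
    [UniformSpace Y] {F : ι → X → Y} {G : X → Y} {l : Filter ι} {m : Filter κ} {φ : κ → ι}
    (h : TendstoLocallyUniformly F G l) (hφ : Tendsto φ m l) :
    TendstoLocallyUniformly (fun k => F (φ k)) G m := by
  intro u hu x
  obtain ⟨t, ht, hF⟩ := h u hu x
  exact ⟨t, ht, hφ.eventually hF⟩

theorem tendstoLocallyUniformly_const {X Y : Type*} [TopologicalSpace X]
    [UniformSpace Y] (G : X → Y) :
    TendstoLocallyUniformly (fun _ : ℕ => G) G atTop :=
  fun _ hu _ => ⟨univ, univ_mem, .of_forall fun _ _ _ => refl_mem_uniformity hu⟩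

/-- Kuratowski convergence of a sequence of sets. -/
structure KuratowskiTendsto {E : Type*} [PseudoMetricSpace E] (S : ℕ → Set E) (K : Set E) :
    Prop where
  lower : ∀ z ∈ K, Tendsto (fun k => infDist z (S k)) atTop (𝓝 0)
  upper : ∀ φ : ℕ → ℕ, Tendsto φ atTop atTop → ∀ (w : ℕ → E) (z : E),
    (∀ j, w j ∈ S (φ j)) → Tendsto w atTop (𝓝 z) → z ∈ K

namespace KuratowskiTendsto

variable {E : Type*} [PseudoMetricSpace E] [ProperSpace E] {S : ℕ → Set E} {K : Set E}

/-- Nearest points to `z` serve. Nonemptiness matters because `infDist` to the empty set is 0. -/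
theorem exists_seq (h : KuratowskiTendsto S K) (hc : ∀ k, IsClosed (S k))
    (hne : ∀ k, (S k).Nonempty) {z : E} (hz : z ∈ K) :
    ∃ w : ℕ → E, (∀ k, w k ∈ S k) ∧ Tendsto w atTop (𝓝 z) := by
  choose w hw hd using fun k => (hc k).exists_infDist_eq_dist (hne k) z
  refine ⟨w, hw, ?_⟩
  rw [tendsto_iff_dist_tendsto_zero]
  simpa only [hd, dist_comm] using h.lower z hz

theorem tendsto_infDist (h : KuratowskiTendsto S K) (hc : ∀ k, IsClosed (S k))
    (hne : ∀ k, (S k).Nonempty) (hKc : IsClosed K) (hK : K.Nonempty) {y : ℕ → E} {y₀ : E}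
    (hy : Tendsto y atTop (𝓝 y₀)) :
    Tendsto (fun k => infDist (y k) (S k)) atTop (𝓝 (infDist y₀ K)) := by
  choose w hw hd using fun k => (hc k).exists_infDist_eq_dist (hne k) (y k)
  obtain ⟨z, hz, hzd⟩ := hKc.exists_infDist_eq_dist hK y₀
  obtain ⟨v, hv, hvz⟩ := h.exists_seq hc hne hz
  have hup : Tendsto (fun k => dist (y k) (v k)) atTop (𝓝 (infDist y₀ K)) := by
    rw [hzd]; exact hy.dist hvz
  have hle : ∀ k, dist (y k) (w k) ≤ dist (y k) (v k) := fun k => by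
    rw [← hd k]; exact infDist_le_dist_of_mem (hv k)
  simp only [hd]
  have hbw : Bornology.IsBounded (range w) := by
    have h1 : Tendsto (fun k => dist (y k) y₀ + dist (y k) (v k)) atTop
        (𝓝 (dist y₀ y₀ + infDist y₀ K)) := (hy.dist tendsto_const_nhds).add hup
    obtain ⟨M, hM⟩ := h1.bddAbove_range
    refine (isBounded_closedBall (x := y₀) (r := M)).subset ?_
    rintro _ ⟨k, rfl⟩
    have := hM (mem_range_self k)
    have h2 := dist_triangle_left (w k) y₀ (y k)
    simp only [mem_closedBall]
    linarith [hle k]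
  refine tendsto_of_subseq_tendsto fun ns hns => ?_
  obtain ⟨a, -, φ, hφ, ha⟩ := tendsto_subseq_of_bounded hbw (x := w ∘ ns) fun k => mem_range_self _
  have hnφ : Tendsto (fun j => ns (φ j)) atTop atTop := hns.comp hφ.tendsto_atTop
  have haK : a ∈ K := h.upper _ hnφ _ a (fun j => hw _) ha
  have hlim : Tendsto (fun j => dist (y (ns (φ j))) (w (ns (φ j)))) atTop (𝓝 (dist y₀ a)) :=
    (hy.comp hnφ).dist ha
  -- A cluster point of the nearest points lies in `K` and does no worse than the recovery sequence
  -- of a projection of `y₀`.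
  have : dist y₀ a = infDist y₀ K := le_antisymm
    (le_of_tendsto_of_tendsto' hlim (hup.comp hnφ) fun j => hle _)
    (infDist_le_dist_of_mem haK)
  exact ⟨φ, this ▸ hlim⟩

end KuratowskiTendsto

end Convergence

/-! ### Truncated sets, support functions and Steiner points -/

section Steiner

theorem isCompact_nearSet {E : Type*} [NormedAddCommGroup E] [ProperSpace E]
    (y : E) {K : Set E} (hK : IsClosed K) :
    IsCompact (nearSet y K) :=
  (isCompact_closedBall y _).inter_left hK

theorem nearSet_nonempty {E : Type*} [NormedAddCommGroup E] [ProperSpace E]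
    (y : E) {K : Set E} (hK : IsClosed K)
    (hne : K.Nonempty) : (nearSet y K).Nonempty := by
  obtain ⟨z, hz, hd⟩ := hK.exists_infDist_eq_dist hne y
  refine ⟨z, hz, ?_⟩
  rw [mem_closedBall, dist_comm, ← hd]
  linarith [infDist_nonneg (x := y) (s := K)]

variable {E : Type*} [NormedAddCommGroup E] [InnerProductSpace ℝ E]

theorem KuratowskiTendsto.nearSet [ProperSpace E] {S : ℕ → Set E} {K : Set E}
    (h : KuratowskiTendsto S K) (hc : ∀ k, IsClosed (S k)) (hne : ∀ k, (S k).Nonempty)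
    (hKc : IsClosed K) (hK : K.Nonempty) (hconv : Convex ℝ K) {y : ℕ → E} {y₀ : E}
    (hy : Tendsto y atTop (𝓝 y₀)) :
    KuratowskiTendsto (fun k => nearSet (y k) (S k)) (nearSet y₀ K) := by
  have hd := h.tendsto_infDist hc hne hKc hK hy
  constructor
  · rintro z ⟨hzK, hzd⟩
    -- If `d(y₀, K) = 0`, the limit set is just `{y₀}` and the balls shrink to it. Otherwise there
    -- is room to move `z` inside the ball.
    rcases (infDist_nonneg (x := y₀) (s := K)).eq_or_lt with h0 | h0
    · have hzy : z = y₀ := by rw [← h0] at hzd; simpa using hzd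
      choose w hw using fun k => nearSet_nonempty (y k) (hc k) (hne k)
      have hlim : Tendsto (fun k => dist y₀ (y k) + 2 * infDist (y k) (S k)) atTop (𝓝 0) := by
        have := (tendsto_const_nhds (x := y₀)).dist hy |>.add (hd.const_mul 2)
        simpa [← h0] using this
      refine squeeze_zero (fun _ => infDist_nonneg) (fun k => ?_) hlim
      rw [hzy]
      refine (infDist_le_dist_of_mem (hw k)).trans ?_
      have h1 := dist_triangle y₀ (y k) (w k)
      have h2 := (hw k).2
      rw [mem_closedBall, dist_comm] at h2
      linarith
    · obtain ⟨z', hz', hd'⟩ := hKc.exists_infDist_eq_dist hK y₀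
      have key : ∀ s ∈ Ioo (0 : ℝ) 1, ∀ᶠ k in atTop,
          infDist z (HJRep.nearSet (y k) (S k)) ≤ 2 * s * (‖z' - z‖ + 1) := by
        intro s hs
        set q := z + s • (z' - z) with hq
        have hqK : q ∈ K := hconv.add_smul_sub_mem hzK hz' ⟨hs.1.le, hs.2.le⟩
        -- Moving from `z` towards the projection `z'` brings the distance to at most `(2 - s) d < 2
        -- d`, so points recovering `q` eventually satisfy the ball constraint.
        have hqd : dist q y₀ < 2 * infDist y₀ K := by
          have e : q - y₀ = (1 - s) • (z - y₀) + s • (z' - y₀) := by rw [hq]; module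
          rw [dist_eq_norm, e]
          have h1 := norm_add_le ((1 - s) • (z - y₀)) (s • (z' - y₀))
          rw [norm_smul, norm_smul, Real.norm_of_nonneg hs.1.le,
            Real.norm_of_nonneg (sub_nonneg.2 hs.2.le)] at h1
          rw [mem_closedBall, dist_eq_norm] at hzd
          rw [dist_comm, dist_eq_norm] at hd'
          rw [← hd'] at h1
          nlinarith [hs.1, hs.2, mul_le_mul_of_nonneg_left hzd (sub_nonneg.2 hs.2.le),
            mul_pos hs.1 h0]
        obtain ⟨w, hw, hwq⟩ := h.exists_seq hc hne hqK
        have e1 : ∀ᶠ k in atTop, dist (w k) (y k) < 2 * infDist (y k) (S k) :=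
          (hwq.dist hy).eventually_lt (hd.const_mul 2) hqd
        have e2 : ∀ᶠ k in atTop, dist (w k) q < s := by
          rw [tendsto_iff_dist_tendsto_zero] at hwq
          exact hwq.eventually_lt_const hs.1
        filter_upwards [e1, e2] with k hk1 hk2
        have hmem : w k ∈ HJRep.nearSet (y k) (S k) := ⟨hw k, hk1.le⟩
        refine (infDist_le_dist_of_mem hmem).trans ?_
        have h3 : dist z q = s * ‖z' - z‖ := by
          rw [dist_comm, dist_eq_norm, hq, add_sub_cancel_left, norm_smul,
            Real.norm_of_nonneg hs.1.le]
        have h4 := dist_triangle z q (w k)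
        rw [dist_comm q] at h4
        nlinarith [hs.1, norm_nonneg (z' - z), mul_nonneg hs.1.le (norm_nonneg (z' - z))]
      rw [Metric.tendsto_atTop']
      intro ε hε
      have hN : 0 < ‖z' - z‖ + 1 := by positivity
      obtain ⟨s, hs0, hs1, hsε⟩ : ∃ s : ℝ, 0 < s ∧ s < 1 ∧ 2 * s * (‖z' - z‖ + 1) < ε := by
        refine ⟨min (1 / 2) (ε / (4 * (‖z' - z‖ + 1))), by positivity,
          (min_le_left _ _).trans_lt (by norm_num), ?_⟩
        have := min_le_right (1 / 2 : ℝ) (ε / (4 * (‖z' - z‖ + 1)))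
        rw [le_div_iff₀ (by positivity)] at this
        linarith
      obtain ⟨N, hN⟩ := (key s ⟨hs0, hs1⟩).exists_forall_of_atTop
      refine ⟨N, fun k hk => ?_⟩
      rw [Real.dist_0_eq_abs, abs_of_nonneg infDist_nonneg]
      exact (hN k hk.le).trans_lt hsε
  · intro φ hφ w z hw hwz
    refine ⟨h.upper φ hφ w z (fun j => (hw j).1) hwz, ?_⟩
    exact le_of_tendsto_of_tendsto' (hwz.dist (hy.comp hφ)) ((hd.comp hφ).const_mul 2)
      fun j => (hw j).2

theorem exists_supportFun_eq {K : Set E} (hK : IsCompact K) (hne : K.Nonempty) (p : E) :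
    ∃ z ∈ K, supportFun K p = ⟪p, z⟫ :=
  hK.exists_sSup_image_eq hne (by fun_prop)

theorem inner_le_supportFun {K : Set E} (hK : IsCompact K) {p z : E} (hz : z ∈ K) :
    ⟪p, z⟫ ≤ supportFun K p :=
  le_csSup (hK.image (f := fun x => ⟪p, x⟫) (by fun_prop)).bddAbove (mem_image_of_mem _ hz)

theorem continuous_supportFun {K : Set E} (hK : IsCompact K) :
    Continuous (supportFun K) :=
  hK.continuous_sSup (f := fun p x => ⟪p, x⟫) (by fun_prop)

theorem abs_supportFun_le {K : Set E} (hK : IsCompact K) (hne : K.Nonempty) {R : ℝ}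
    (hR : K ⊆ closedBall 0 R) (p : E) : |supportFun K p| ≤ ‖p‖ * R := by
  obtain ⟨z, hz, h⟩ := exists_supportFun_eq hK hne p
  rw [h]
  exact (abs_real_inner_le_norm p z).trans
    (mul_le_mul_of_nonneg_left (mem_closedBall_zero_iff.1 (hR hz)) (norm_nonneg _))

/-- Maximizers over `S k` cluster in `K`, which bounds the limit above; recovering a maximizer over
`K` bounds it below. -/
theorem KuratowskiTendsto.tendsto_supportFun [ProperSpace E] {S : ℕ → Set E} {K : Set E}
    (h : KuratowskiTendsto S K) (hc : ∀ k, IsCompact (S k)) (hne : ∀ k, (S k).Nonempty)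
    (hKc : IsCompact K) (hK : K.Nonempty) {R : ℝ} (hR : ∀ k, S k ⊆ closedBall 0 R) (p : E) :
    Tendsto (fun k => supportFun (S k) p) atTop (𝓝 (supportFun K p)) := by
  choose w hw hs using fun k => exists_supportFun_eq (hc k) (hne k) p
  obtain ⟨z, hz, hzs⟩ := exists_supportFun_eq hKc hK p
  obtain ⟨v, hv, hvz⟩ := h.exists_seq (fun k => (hc k).isClosed) hne hz
  refine tendsto_of_subseq_tendsto fun ns hns => ?_
  obtain ⟨a, -, φ, hφ, ha⟩ := tendsto_subseq_of_bounded (isBounded_closedBall (x := (0 : E)))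
    (x := w ∘ ns) fun k => hR _ (hw _)
  have hnφ : Tendsto (fun j => ns (φ j)) atTop atTop := hns.comp hφ.tendsto_atTop
  have haK : a ∈ K := h.upper _ hnφ _ a (fun j => hw _) ha
  have hlim : Tendsto (fun j => supportFun (S (ns (φ j))) p) atTop (𝓝 ⟪p, a⟫) := by
    simp only [hs]
    exact tendsto_const_nhds.inner ha
  have : ⟪p, a⟫ = supportFun K p := by
    refine le_antisymm (inner_le_supportFun hKc haK) ?_
    rw [hzs]
    exact le_of_tendsto_of_tendsto' (tendsto_const_nhds.inner (hvz.comp hnφ)) hlim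
      fun j => inner_le_supportFun (hc _) (hv _)
  exact ⟨φ, this ▸ hlim⟩

theorem KuratowskiTendsto.tendsto_steinerPoint [FiniteDimensional ℝ E] [MeasurableSpace E]
    [BorelSpace E] {S : ℕ → Set E} {K : Set E}
    (h : KuratowskiTendsto S K) (hc : ∀ k, IsCompact (S k)) (hne : ∀ k, (S k).Nonempty)
    (hKc : IsCompact K) (hK : K.Nonempty) {R : ℝ} (hR : ∀ k, S k ⊆ closedBall 0 R) :
    Tendsto (fun k => steinerPoint (S k)) atTop (𝓝 (steinerPoint K)) := by
  have : ProperSpace E := FiniteDimensional.proper ℝ E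
  unfold steinerPoint
  simp only [average_eq]
  refine (Tendsto.const_smul ?_ _).const_smul _
  refine tendsto_integral_of_dominated_convergence (fun _ => R) (fun k => ?_)
    (integrable_const R) (fun k => .of_forall fun p => ?_) (.of_forall fun p => ?_)
  · have := continuous_supportFun (hc k)
    exact (by fun_prop :
      Continuous fun p : sphere (0 : E) 1 => supportFun (S k) (p : E) • (p : E)).aestronglyMeasurable
  · have hp : ‖(p : E)‖ = 1 := by simp
    have := abs_supportFun_le (hc k) (hne k) (hR k) p
    simpa [norm_smul, hp] using this
  · exact (h.tendsto_supportFun hc hne hKc hK hR p).smul_const _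

theorem KuratowskiTendsto.tendsto_steinerPoint_nearSet [FiniteDimensional ℝ E]
    [MeasurableSpace E] [BorelSpace E] {S : ℕ → Set E} {K : Set E}
    (h : KuratowskiTendsto S K) (hc : ∀ k, IsClosed (S k)) (hne : ∀ k, (S k).Nonempty)
    (hKc : IsClosed K) (hK : K.Nonempty) (hconv : Convex ℝ K) {y : ℕ → E} {y₀ : E}
    (hy : Tendsto y atTop (𝓝 y₀)) :
    Tendsto (fun k => steinerPoint (HJRep.nearSet (y k) (S k))) atTop
      (𝓝 (steinerPoint (HJRep.nearSet y₀ K))) := by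
  have : ProperSpace E := FiniteDimensional.proper ℝ E
  have hd := (h.tendsto_infDist hc hne hKc hK hy).const_mul 2
  obtain ⟨R, hR⟩ := (hy.norm.add hd).bddAbove_range
  refine (h.nearSet hc hne hKc hK hconv hy).tendsto_steinerPoint
    (fun k => isCompact_nearSet _ (hc k)) (fun k => nearSet_nonempty _ (hc k) (hne k))
    (isCompact_nearSet _ hKc) (nearSet_nonempty _ hKc hK) (R := R) fun k z hz => ?_
  have h1 : dist z (y k) ≤ _ := hz.2
  have h2 := hR (mem_range_self k)
  have h3 := norm_le_norm_add_norm_sub (y k) z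
  rw [dist_comm, dist_eq_norm] at h1
  rw [mem_closedBall_zero_iff]
  linarith

end Steiner

/-! ### Stability of epigraphs of convex conjugates -/

section Conjugate

variable {V : Type*} [NormedAddCommGroup V] [InnerProductSpace ℝ V]

/-- The epigraph of the Legendre-Fenchel conjugate. -/
def conjEpi (h : V → ℝ) : Set (WithLp 2 (V × ℝ)) :=
  {z | ∀ p, ⟪z.fst, p⟫ - h p ≤ z.snd}

theorem isClosed_conjEpi (h : V → ℝ) : IsClosed (conjEpi h) := by
  have h1 := WithLp.continuous_fst 2 V ℝ
  have h2 := WithLp.continuous_snd 2 V ℝ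
  simp only [conjEpi, ofPred_forall]
  exact isClosed_iInter fun p => isClosed_le (by fun_prop) h2

theorem convex_conjEpi (h : V → ℝ) : Convex ℝ (conjEpi h) := by
  intro z hz w hw a b ha hb hab p
  have e1 : (a • z + b • w).fst = a • z.fst + b • w.fst := rfl
  have e2 : (a • z + b • w).snd = a * z.snd + b * w.snd := rfl
  rw [e1, e2, inner_add_left, real_inner_smul_left, real_inner_smul_left]
  have hb' : b = 1 - a := by linarith
  subst hb'
  nlinarith [mul_le_mul_of_nonneg_left (hz p) ha, mul_le_mul_of_nonneg_left (hw p) hb]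

/-- A minimizer `p` of `h - ⟨v,·⟩ + ε/2 |·|²` has `v - ε p` as a subgradient of `h`. -/
theorem exists_regularized_subgradient [ProperSpace V] {h : V → ℝ} (hconv : ConvexOn ℝ univ h)
    {C : ℝ} (hlip : ∀ p q, |h p - h q| ≤ C * ‖p - q‖) (v : V) {ε : ℝ} (hε : 0 < ε) :
    ∃ p, (∀ q, ⟪v - ε • p, q⟫ - h q ≤ ⟪v - ε • p, p⟫ - h p) ∧
      h p - ⟪v, p⟫ + ε / 2 * ‖p‖ ^ 2 ≤ h 0 := by
  have hcont : Continuous h := by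
    have hL : LipschitzWith C.toNNReal h := LipschitzWith.of_dist_le_mul fun p q => by
      rw [Real.dist_eq, dist_eq_norm]
      exact (hlip p q).trans (mul_le_mul_of_nonneg_right (Real.le_coe_toNNReal C) (norm_nonneg _))
    exact hL.continuous
  have hcoer : Tendsto (fun p => h p - ⟪v, p⟫ + ε / 2 * ‖p‖ ^ 2) (cocompact V) atTop := by
    -- The Lipschitz bound allows at most linear decrease, which the quadratic term dominates.
    have h1 : Tendsto (fun r : ℝ => h 0 + r * (ε / 2 * r - (C + ‖v‖))) atTop atTop := by
      refine tendsto_atTop_add_const_left _ _ (tendsto_id.atTop_mul_atTop₀ ?_)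
      exact tendsto_atTop_add_const_right _ _ (tendsto_id.const_mul_atTop (by positivity))
    refine tendsto_atTop_mono (fun p => ?_) (h1.comp (tendsto_norm_cocompact_atTop (E := V)))
    have h2 := (abs_le.1 (hlip p 0)).1
    rw [sub_zero] at h2
    have h3 := real_inner_le_norm v p
    simp only [Function.comp]
    nlinarith
  obtain ⟨p, hp⟩ := Continuous.exists_forall_le (by fun_prop) hcoer
  refine ⟨p, fun q => ?_, by simpa using hp 0⟩
  -- Compare `p` with `p + s (q - p)`, use convexity and divide by `s`; the remaining quadratic term
  -- vanishes as `s → 0`.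
  have hs : ∀ s ∈ Ioo (0 : ℝ) 1,
      0 ≤ h q - h p - ⟪v - ε • p, q - p⟫ + s * (ε / 2 * ‖q - p‖ ^ 2) := by
    intro s hs
    have h1 := hp (p + s • (q - p))
    have h2 := hconv.2 (mem_univ p) (mem_univ q) (sub_nonneg.2 hs.2.le) hs.1.le (by ring)
    have e : (1 - s) • p + s • q = p + s • (q - p) := by module
    rw [e, smul_eq_mul, smul_eq_mul] at h2
    rw [norm_add_sq_real, inner_add_right, real_inner_smul_right, real_inner_smul_right,
      norm_smul, Real.norm_of_nonneg hs.1.le] at h1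
    rw [inner_sub_left, real_inner_smul_left]
    have h3 : 0 ≤ s * (h q - h p - (⟪v, q - p⟫ - ε * ⟪p, q - p⟫) +
        s * (ε / 2 * ‖q - p‖ ^ 2)) := by nlinarith
    exact nonneg_of_mul_nonneg_right h3 hs.1
  have hlim : Tendsto (fun s : ℝ => h q - h p - ⟪v - ε • p, q - p⟫ + s * (ε / 2 * ‖q - p‖ ^ 2))
      (𝓝[>] 0) (𝓝 (h q - h p - ⟪v - ε • p, q - p⟫ + 0 * (ε / 2 * ‖q - p‖ ^ 2))) :=
    Tendsto.mono_left (Continuous.tendsto (by fun_prop) 0) nhdsWithin_le_nhds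
  have h0 := ge_of_tendsto hlim
    (Filter.mem_of_superset (Ioo_mem_nhdsGT (zero_lt_one' ℝ)) hs)
  rw [zero_mul, add_zero, inner_sub_right] at h0
  linarith

theorem conjEpi_nonempty [ProperSpace V] {h : V → ℝ} (hconv : ConvexOn ℝ univ h)
    {C : ℝ} (hlip : ∀ p q, |h p - h q| ≤ C * ‖p - q‖) : (conjEpi h).Nonempty := by
  obtain ⟨p, hp, -⟩ := exists_regularized_subgradient hconv hlip 0 one_pos
  exact ⟨WithLp.toLp 2 (0 - (1 : ℝ) • p, ⟪0 - (1 : ℝ) • p, p⟫ - h p), hp⟩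

theorem kuratowskiTendsto_conjEpi [ProperSpace V] {h : ℕ → V → ℝ} {g : V → ℝ}
    (hconv : ∀ k, ConvexOn ℝ univ (h k)) {C : ℝ} (hC : 0 ≤ C)
    (hlip : ∀ k p q, |h k p - h k q| ≤ C * ‖p - q‖)
    (hg : TendstoLocallyUniformly h g atTop) :
    KuratowskiTendsto (fun k => conjEpi (h k)) (conjEpi g) := by
  have hpt : ∀ p, Tendsto (fun k => h k p) atTop (𝓝 (g p)) := fun p =>
    hg.tendstoLocallyUniformlyOn (s := univ) |>.tendsto_at (mem_univ p)
  have h1 := WithLp.continuous_fst 2 V ℝ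
  have h2 := WithLp.continuous_snd 2 V ℝ
  constructor
  · intro z hz
    obtain ⟨D, hD⟩ := (hpt 0).bddAbove_range
    replace hD : ∀ k, h k 0 ≤ D := fun k => hD (mem_range_self k)
    -- Minimality against `0`, `z ∈ conjEpi g` and `|h k p - g p| < ε < 1` give `ε / 2 * ‖p‖ ^ 2 ≤
    -- |D| + |z.snd| + 1`.
    set M := 2 * (|D| + |z.snd| + 1) with hM
    have hMpos : 0 < M := by positivity
    have key : ∀ ε ∈ Ioo (0 : ℝ) 1, ∀ᶠ k in atTop,
        infDist z (conjEpi (h k)) ^ 2 ≤ ε * M + ε ^ 2 := by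
      intro ε hε
      -- This radius bounds the minimizer for every `k`: minimality and the Lipschitz bound give `ε
      -- / 2 * ‖p‖ ^ 2 ≤ (C + ‖z.fst‖) * ‖p‖`.
      have hunif := tendstoLocallyUniformly_iff_forall_isCompact.1 hg
        (closedBall 0 (2 * (C + ‖z.fst‖) / ε)) (isCompact_closedBall _ _)
      filter_upwards [Metric.tendstoUniformlyOn_iff.1 hunif ε hε.1] with k hk
      obtain ⟨p, hp, hp0⟩ := exists_regularized_subgradient (hconv k) (hlip k) z.fst hε.1
      have hpball : p ∈ closedBall (0 : V) (2 * (C + ‖z.fst‖) / ε) := by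
        rw [mem_closedBall_zero_iff, le_div_iff₀ hε.1]
        have h3 := (abs_le.1 (hlip k p 0)).1
        rw [sub_zero] at h3
        have h4 := real_inner_le_norm z.fst p
        rcases (norm_nonneg p).eq_or_lt with h0 | h0
        · rw [← h0, zero_mul]
          positivity
        · refine le_of_mul_le_mul_right (a := ‖p‖) ?_ h0
          nlinarith
      have hgk := abs_lt.1 (hk p hpball)
      have hzp := hz p
      have hsub : ε * ‖p‖ ^ 2 ≤ M := by
        have := hD k
        have := le_abs_self D
        have := le_abs_self z.snd
        rw [hM]
        linarith [hε.2, hgk.2, hgk.1]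
      -- The conjugate of `h k` at `z.fst - ε • p` is attained at `p`; raising the height by `ε`
      -- absorbs the error between `h k p` and `g p`.
      have hmem : WithLp.toLp 2 (z.fst - ε • p, z.snd + ε) ∈ conjEpi (h k) := by
        intro q
        refine (hp q).trans ?_
        change _ ≤ z.snd + ε
        rw [inner_sub_left, real_inner_smul_left, real_inner_self_eq_norm_sq]
        have : 0 ≤ ε * ‖p‖ ^ 2 := by have := hε.1; positivity
        linarith [hgk.1, hgk.2]
      have hdist := infDist_le_dist_of_mem (x := z) hmem
      have hsq : dist z (WithLp.toLp 2 (z.fst - ε • p, z.snd + ε)) ^ 2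
          = ε * (ε * ‖p‖ ^ 2) + ε ^ 2 := by
        rw [dist_eq_norm, WithLp.prod_norm_sq_eq_of_L2]
        have e1 : (z - WithLp.toLp 2 (z.fst - ε • p, z.snd + ε)).fst = ε • p := by
          change z.fst - (z.fst - ε • p) = _
          abel
        have e2 : (z - WithLp.toLp 2 (z.fst - ε • p, z.snd + ε)).snd = -ε := by
          change z.snd - (z.snd + ε) = _
          ring
        rw [e1, e2, norm_smul, Real.norm_of_nonneg hε.1.le, norm_neg,
          Real.norm_of_nonneg hε.1.le]
        ring
      calc infDist z (conjEpi (h k)) ^ 2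
          ≤ dist z (WithLp.toLp 2 (z.fst - ε • p, z.snd + ε)) ^ 2 :=
            pow_le_pow_left₀ infDist_nonneg hdist 2
        _ ≤ ε * M + ε ^ 2 := by
            rw [hsq]
            linarith [mul_le_mul_of_nonneg_left hsub hε.1.le]
    have hsmall : Tendsto (fun ε : ℝ => ε * M + ε ^ 2) (𝓝[>] 0) (𝓝 0) := by
      have : Tendsto (fun ε : ℝ => ε * M + ε ^ 2) (𝓝 0) (𝓝 (0 * M + 0 ^ 2)) :=
        Continuous.tendsto (by fun_prop) 0
      simpa using this.mono_left nhdsWithin_le_nhds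
    rw [Metric.tendsto_nhds]
    intro δ hδ
    obtain ⟨ε, hε1, hε2⟩ := ((hsmall.eventually_lt_const (pow_pos hδ 2)).and
      (Ioo_mem_nhdsGT (zero_lt_one' ℝ))).exists
    filter_upwards [key ε hε2] with k hk
    rw [Real.dist_0_eq_abs, abs_of_nonneg infDist_nonneg]
    exact lt_of_pow_lt_pow_left₀ 2 hδ.le (hk.trans_lt hε1)
  · intro φ hφ w z hw hwz p
    have h3 : Tendsto (fun j => (w j).fst) atTop (𝓝 z.fst) := (h1.tendsto z).comp hwz
    have h4 : Tendsto (fun j => (w j).snd) atTop (𝓝 z.snd) := (h2.tendsto z).comp hwz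
    exact le_of_tendsto_of_tendsto' ((h3.inner tendsto_const_nhds).sub ((hpt p).comp hφ)) h4
      fun j => hw j p

end Conjugate

/-! ### Convergence of the representations -/

section Representation

variable {n : ℕ} {T : ℝ}

theorem epiLagrangian_eq_conjEpi (H : Time T → Rn n → Rn n → ℝ) (t : Time T) (x : Rn n) :
    epiLagrangian H t x = conjEpi (H t x) := by
  ext z
  simp only [epiLagrangian, lagrangian, conjEpi, mem_ofPred_eq, iSup_le_iff, EReal.coe_le_coe_iff]

theorem tendsto_epiParam {Hs : ℕ → Time T → Rn n → Rn n → ℝ} {lams : ℕ → Time T → Rn n → ℝ}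
    {cs : ℕ → Time T → ℝ} {H : Time T → Rn n → Rn n → ℝ} {lam : Time T → Rn n → ℝ}
    {c : Time T → ℝ}
    (hyps : ∀ i, StandingHyp (Hs i) (lams i) (cs i)) (hyp : StandingHyp H lam c)
    (hH : Continuous fun z : Time T × Rn n × Rn n => H z.1 z.2.1 z.2.2)
    (hlam : Continuous fun z : Time T × Rn n => lam z.1 z.2)
    (hc : Continuous c)
    (hHs : TendstoLocallyUniformly
      (fun i (z : Time T × Rn n × Rn n) => Hs i z.1 z.2.1 z.2.2)
      (fun z => H z.1 z.2.1 z.2.2) atTop)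
    (hlams : TendstoLocallyUniformly
      (fun i (z : Time T × Rn n) => lams i z.1 z.2) (fun z => lam z.1 z.2) atTop)
    (hcs : TendstoLocallyUniformly cs c atTop)
    {t : ℕ → Time T} {x : ℕ → Rn n} {a : ℕ → UnitBall n}
    {t₀ : Time T} {x₀ : Rn n} {a₀ : UnitBall n}
    (ht : Tendsto t atTop (𝓝 t₀)) (hx : Tendsto x atTop (𝓝 x₀)) (ha : Tendsto a atTop (𝓝 a₀)) :
    Tendsto (fun k => epiParam (Hs k) (lams k) (cs k) (t k) (x k) (a k)) atTop
      (𝓝 (epiParam H lam c t₀ x₀ a₀)) := by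
  have hHt : ∀ (φ : ℕ → ℕ) (p : ℕ → Rn n) (p₀ : Rn n), Tendsto φ atTop atTop →
      Tendsto p atTop (𝓝 p₀) →
      Tendsto (fun k => Hs (φ k) (t (φ k)) (x (φ k)) (p k)) atTop (𝓝 (H t₀ x₀ p₀)) := by
    intro φ p p₀ hφ hp
    exact (hHs.comp_index hφ).tendsto_comp hH.continuousAt
      ((ht.comp hφ).prodMk_nhds ((hx.comp hφ).prodMk_nhds hp))
  have hlamt : Tendsto (fun k => lams k (t k) (x k)) atTop (𝓝 (lam t₀ x₀)) :=
    hlams.tendsto_comp hlam.continuousAt (ht.prodMk_nhds hx)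
  have hct : Tendsto (fun k => cs k (t k) * (1 + ‖x k‖)) atTop (𝓝 (c t₀ * (1 + ‖x₀‖))) :=
    (hcs.tendsto_comp hc.continuousAt ht).mul (hx.norm.const_add 1)
  have hω : Tendsto (fun k => omega (Hs k) (lams k) (cs k) (t k) (x k)) atTop
      (𝓝 (omega H lam c t₀ x₀)) :=
    ((hlamt.abs.add (hHt id _ 0 tendsto_id tendsto_const_nhds).abs).add hct).add_const 1
  -- A convergent sequence is bounded, so (H4) yields one Lipschitz constant for all frozen
  -- Hamiltonians.
  obtain ⟨C, hC⟩ := hct.bddAbove_range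
  have hC0 : 0 ≤ C := (mul_nonneg ((hyps 0).h4.2.1 _) (by positivity)).trans
    (hC (mem_range_self 0))
  have hlip : ∀ k p q, |Hs k (t k) (x k) p - Hs k (t k) (x k) q| ≤ C * ‖p - q‖ := fun k p q =>
    ((hyps k).h4.2.2 (t k) (x k) p q).trans
      (mul_le_mul_of_nonneg_right (hC (mem_range_self k)) (norm_nonneg _))
  have hloc : TendstoLocallyUniformly (fun k => Hs k (t k) (x k)) (H t₀ x₀) atTop :=
    tendstoLocallyUniformly_of_seq
      (hH.comp (by fun_prop : Continuous fun p : Rn n => (t₀, x₀, p))) hHt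
  have hy : Tendsto (fun k => omega (Hs k) (lams k) (cs k) (t k) (x k) • (a k : Rn1 n)) atTop
      (𝓝 (omega H lam c t₀ x₀ • (a₀ : Rn1 n))) :=
    hω.smul ((continuous_subtype_val.tendsto a₀).comp ha)
  unfold epiParam
  simp only [epiLagrangian_eq_conjEpi]
  exact (kuratowskiTendsto_conjEpi (fun k => (hyps k).h3 _ _) hC0 hlip
    hloc).tendsto_steinerPoint_nearSet (fun k => isClosed_conjEpi _)
    (fun k => conjEpi_nonempty ((hyps k).h3 _ _) (hlip k)) (isClosed_conjEpi _)
    (conjEpi_nonempty (hyp.h3 _ _) (hyp.h4.2.2 _ _)) (convex_conjEpi _) hy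

end Representation

end HJRep


theorem theorem3p4 (n : ℕ) (T : ℝ)
    (Hs : ℕ → HJRep.Time T → HJRep.Rn n → HJRep.Rn n → ℝ)
    (lams : ℕ → HJRep.Time T → HJRep.Rn n → ℝ)
    (cs : ℕ → HJRep.Time T → ℝ)
    (H : HJRep.Time T → HJRep.Rn n → HJRep.Rn n → ℝ)
    (lam : HJRep.Time T → HJRep.Rn n → ℝ)
    (c : HJRep.Time T → ℝ)
    (hyps : ∀ i, HJRep.StandingHyp (Hs i) (lams i) (cs i))
    (hyp : HJRep.StandingHyp H lam c)
    (hHs_cont : ∀ i, Continuous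
      fun z : HJRep.Time T × HJRep.Rn n × HJRep.Rn n => Hs i z.1 z.2.1 z.2.2)
    (hlams_cont : ∀ i, Continuous fun z : HJRep.Time T × HJRep.Rn n => lams i z.1 z.2)
    (hcs_cont : ∀ i, Continuous (cs i))
    (hH_lim : HJRep.TendstoUniformlyOnCompacts
      (fun i (z : HJRep.Time T × HJRep.Rn n × HJRep.Rn n) => Hs i z.1 z.2.1 z.2.2)
      (fun z => H z.1 z.2.1 z.2.2))
    (hlam_lim : HJRep.TendstoUniformlyOnCompacts
      (fun i (z : HJRep.Time T × HJRep.Rn n) => lams i z.1 z.2) (fun z => lam z.1 z.2))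
    (hc_lim : HJRep.TendstoUniformlyOnCompacts cs c) :
    HJRep.TendstoUniformlyOnCompacts
      (fun i (z : HJRep.Time T × HJRep.Rn n × HJRep.UnitBall n) =>
        HJRep.reprF (Hs i) (lams i) (cs i) z.1 z.2.1 z.2.2)
      (fun z => HJRep.reprF H lam c z.1 z.2.1 z.2.2) ∧
    HJRep.TendstoUniformlyOnCompacts
      (fun i (z : HJRep.Time T × HJRep.Rn n × HJRep.UnitBall n) =>
        HJRep.reprL (Hs i) (lams i) (cs i) z.1 z.2.1 z.2.2)
      (fun z => HJRep.reprL H lam c z.1 z.2.1 z.2.2) := by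
  have hH_lu := tendstoLocallyUniformly_iff_forall_isCompact.2 hH_lim
  have hlam_lu := tendstoLocallyUniformly_iff_forall_isCompact.2 hlam_lim
  have hc_lu := tendstoLocallyUniformly_iff_forall_isCompact.2 hc_lim
  -- The limit data inherit continuity from the approximations.
  have hH := hH_lu.continuous (.of_forall hHs_cont)
  have hlam := hlam_lu.continuous (.of_forall hlams_cont)
  have hc := hc_lu.continuous (.of_forall hcs_cont)
  -- Continuity of the limit parametrization is the case of constant sequences of data.
  have hcont : Continuous fun z : HJRep.Time T × HJRep.Rn n × HJRep.UnitBall n =>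
      HJRep.epiParam H lam c z.1 z.2.1 z.2.2 := by
    refine continuous_iff_continuousAt.2 fun z => tendsto_of_seq_tendsto fun u hu => ?_
    exact HJRep.tendsto_epiParam (fun _ => hyp) hyp hH hlam hc
      (HJRep.tendstoLocallyUniformly_const _) (HJRep.tendstoLocallyUniformly_const _)
      (HJRep.tendstoLocallyUniformly_const _) hu.fst_nhds hu.snd_nhds.fst_nhds
      hu.snd_nhds.snd_nhds
  have hseq : ∀ (φ : ℕ → ℕ) (u : ℕ → HJRep.Time T × HJRep.Rn n × HJRep.UnitBall n)
      (z : HJRep.Time T × HJRep.Rn n × HJRep.UnitBall n), Tendsto φ atTop atTop →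
      Tendsto u atTop (𝓝 z) →
      Tendsto (fun k => HJRep.epiParam (Hs (φ k)) (lams (φ k)) (cs (φ k))
        (u k).1 (u k).2.1 (u k).2.2) atTop (𝓝 (HJRep.epiParam H lam c z.1 z.2.1 z.2.2)) := by
    intro φ u z hφ hu
    exact HJRep.tendsto_epiParam (fun k => hyps (φ k)) hyp hH hlam hc
      (hH_lu.comp_index hφ) (hlam_lu.comp_index hφ) (hc_lu.comp_index hφ)
      hu.fst_nhds hu.snd_nhds.fst_nhds hu.snd_nhds.snd_nhds
  have hfst := WithLp.continuous_fst 2 (HJRep.Rn n) ℝ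
  have hsnd := WithLp.continuous_snd 2 (HJRep.Rn n) ℝ
  constructor
  · exact tendstoLocallyUniformly_iff_forall_isCompact.1
      (HJRep.tendstoLocallyUniformly_of_seq (hfst.comp hcont) fun φ u z hφ hu =>
        (hfst.tendsto _).comp (hseq φ u z hφ hu))
  · exact tendstoLocallyUniformly_iff_forall_isCompact.1
      (HJRep.tendstoLocallyUniformly_of_seq (hsnd.comp hcont) fun φ u z hφ hu =>
        (hsnd.tendsto _).comp (hseq φ u z hφ hu))
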